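/- Let $\mathcal N:[0,\infty)\to\mathbb R$ be a saturable nonlinearity: $\mathcal N$ is smooth, $\mathcal N'(s)<0$ for $s>0$, $\mathcal N(0)=1$, $\mathcal N(1)=0$, $\lim_{s\to\infty}\mathcal N(s)=\mathcal N_\infty\in(-\infty,0)$, and $\mathcal N^{(k)}(s)\to0$ as $s\to\infty$ for every $k\ge1$. Let $c\in\mathbb R$, $|c|\neq1$, and let $b_*=(u_*,v_*):\mathbb R\to\mathbb R^2$ be the profile of a traveling wave of speed $c$ of $u_t=v_y+\mathcal N(u^2+v^2)v$, $v_t=u_y-\mathcal N(u^2+v^2)u$, i.e. $$u_*'=\frac{\mathcal N(u_*^2+v_*^2)}{1-c^2}(u_*+cv_*),\qquad v_*'=\frac{\mathcal N(u_*^2+v_*^2)}{1-c^2}(-cu_*-v_*),$$ where $b_*(x)$ has limits as $x\to\pm\infty$, each of which is an equilibrium (the origin or a point of the unit circle). Consider the perturbation system in the lab frame for $B=(U,V)$, $$U_t=V_y+\mathcal N_*(U,V)V+[\mathcal N_*(U,V)-\mathcal N_*(0,0)]v_*,\qquad V_t=U_y-\mathcal N_*(U,V)U-[\mathcal N_*(U,V)-\mathcal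 N_*(0,0)]u_*,$$ where $\mathcal N_*(U,V)=\mathcal N\big((u_*+U)^2+(v_*+V)^2\big)$ and $u_*,v_*$ are evaluated at $y-ct$. Write $N_*(y,t;B)$ for its terms without derivatives and $T(t)=\exp\big(t\left[\begin{smallmatrix}0&1\\1&0\end{smallmatrix}\right]\partial_y\big)$. For $B_0\in H^1(\mathbb R;\mathbb R^2)$, a (global mild) solution with initial data $B_0$ is a $B\in C([0,\infty);H^1(\mathbb R;\mathbb R^2))$ with $B(t)=T(t)B_0+\int_0^tT(t-s)N_*(\cdot,s;B(s))\,ds$ for all $t\ge0$; elements of $H^1$ are identified with their continuous representatives. Let $$\Delta(y_0,t_0)=\{(y,t)\in\mathbb R^2:\ |y-y_0|\le t_0-t,\ 0\le t\le t_0\}.$$ 1. Let $y_0\in\mathbb R$, $t_0>0$, and let $B$ be a solution with initial data $B_0\in H^1$. If $B_0=0$ on $[y_0-t_0,y_0+t_0]$, then $B(y,t)=0$ for all $(y,t)\in\Delta(y_0,t_0)$. 2. Let $y_0\in\mathbb R$, $t_0>0$, and let $A$, $B$ be solutions with initial data $A_0,B_0\in H^1$. If $B_0=A_0$ on $[y_0-t_0,y_0+t_0]$,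 then $B(y,t)=A(y,t)$ for all $(y,t)\in\Delta(y_0,t_0)$. 3. Let $\ell\in\mathbb R$, and let $A$, $B$ be solutions with initial data $A_0,B_0\in H^1$. If $B_0=A_0$ on $[\ell,\infty)$, then $B(y,t)=A(y,t)$ whenever $t\ge0$ and $y\ge\ell+t$. Consequently, writing $A$ and $B$ in the moving-frame coordinate $x=y-ct$, we have $B(x,t)=A(x,t)$ whenever $t\ge0$ and $x\ge\ell-(c-1)t$. -/

import Mathlib

open Set Filter Topology MeasureTheory
open scoped ContDiff FourierTransform

noncomputable section

namespace PulseStability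

/-! ### The nonlinearity and the traveling waves -/

/-- A saturable nonlinearity `s ↦ 𝒩(s)`, `0 ≤ s < ∞`: smooth on `[0, ∞)`, with `𝒩' < 0` on
`(0, ∞)`, `𝒩(0) = 1`, `𝒩(1) = 0`, with a finite limit `𝒩_∞ < 0` at infinity, and with all
derivatives tending to `0` at infinity.  No rate of decay is imposed.  Only the values of `N` on
`[0, ∞)` matter. -/
structure IsSaturableNonlinearity (N : ℝ → ℝ) : Prop where
  smooth : ContDiffOn ℝ ∞ N (Ici 0)
  deriv_neg : ∀ s : ℝ, 0 < s → deriv N s < 0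
  map_zero : N 0 = 1
  map_one : N 1 = 0
  saturates : ∃ Ninf : ℝ, Ninf < 0 ∧ Tendsto N atTop (𝓝 Ninf)
  derivs_decay : ∀ k : ℕ, 1 ≤ k → Tendsto (iteratedDeriv k N) atTop (𝓝 0)

/-- `u² + v²` for `b = (u, v)`. -/
def normSq (b : ℝ × ℝ) : ℝ := b.1 ^ 2 + b.2 ^ 2

/-- The spatially uniform equilibria: the origin and the unit circle. -/
def equilibria : Set (ℝ × ℝ) := {b | b = 0 ∨ normSq b = 1}

/-- `b = (u, v)` is the profile of a traveling wave solution of speed `c ≠ ±1` of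
`u_t = v_y + 𝒩(u² + v²) v`, `v_t = u_y - 𝒩(u² + v²) u`, that is, an orbit of the profile
equation that tends to equilibria at `±∞`. -/
structure IsTravelingWave (N : ℝ → ℝ) (c : ℝ) (b : ℝ → ℝ × ℝ) : Prop where
  speed_ne : |c| ≠ 1
  ode_fst : ∀ x : ℝ, HasDerivAt (fun z => (b z).1)
    (N (normSq (b x)) / (1 - c ^ 2) * ((b x).1 + c * (b x).2)) x
  ode_snd : ∀ x : ℝ, HasDerivAt (fun z => (b z).2)
    (N (normSq (b x)) / (1 - c ^ 2) * (-c * (b x).1 - (b x).2)) x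
  limit_atTop : ∃ e ∈ equilibria, Tendsto b atTop (𝓝 e)
  limit_atBot : ∃ e ∈ equilibria, Tendsto b atBot (𝓝 e)

/-! ### The Sobolev space `H¹(ℝ)` -/

/-- `g` is the weak derivative of `f` on the real line. -/
def HasWeakDeriv (f g : ℝ → ℝ × ℝ) : Prop :=
  LocallyIntegrable f ∧ LocallyIntegrable g ∧
    ∀ φ : ℝ → ℝ, ContDiff ℝ ∞ φ → HasCompactSupport φ →
      ∫ y, deriv φ y • f y = -∫ y, φ y • g y

/-- `f ∈ H¹(ℝ; ℝ²)`, where `f` is the continuous representative of its class. -/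
def MemH1 (f : ℝ → ℝ × ℝ) : Prop :=
  Continuous f ∧ MemLp f 2 ∧ ∃ g : ℝ → ℝ × ℝ, MemLp g 2 ∧ HasWeakDeriv f g

/-- `t ↦ B t` is a continuous map from the set of times `S` to `H¹(ℝ; ℝ²)`. -/
def ContinuousOnInH1 (B : ℝ → ℝ → ℝ × ℝ) (S : Set ℝ) : Prop :=
  ∃ G : ℝ → ℝ → ℝ × ℝ,
    (∀ t ∈ S, Continuous (B t) ∧ MemLp (B t) 2 ∧ MemLp (G t) 2 ∧ HasWeakDeriv (B t) (G t)) ∧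
    ∀ t₀ ∈ S, Tendsto
      (fun t => eLpNorm (B t - B t₀) 2 volume + eLpNorm (G t - G t₀) 2 volume)
      (𝓝[S] t₀) (𝓝 0)

/-! ### The perturbation system in the lab frame -/

/-- The lower order terms, at the point `(y, t)` and the value `B = (U, V)`, of the system
`U_t = V_y + 𝒩_*(U,V) V + [𝒩_*(U,V) - 𝒩_*(0,0)] v_*`,
`V_t = U_y - 𝒩_*(U,V) U - [𝒩_*(U,V) - 𝒩_*(0,0)] u_*`,
where `(u_*, v_*) = b (y - c t)` and `𝒩_*(U,V) = 𝒩((u_* + U)² + (v_* + V)²)`. -/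
def labNonlinearity (N : ℝ → ℝ) (c : ℝ) (b : ℝ → ℝ × ℝ) (y t : ℝ) (B : ℝ × ℝ) : ℝ × ℝ :=
  let bs : ℝ × ℝ := b (y - c * t)
  (N (normSq (bs + B)) * B.2 + (N (normSq (bs + B)) - N (normSq bs)) * bs.2,
    -N (normSq (bs + B)) * B.1 - (N (normSq (bs + B)) - N (normSq bs)) * bs.1)

/-- The group `T(t) = exp (t σ₁ ∂_y)`, `σ₁ = [0 1; 1 0]`, of the system `U_t = V_y`, `V_t = U_y`:
it translates `U + V` to the left and `U - V` to the right with speed `1`.  See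
`fourierVec_freeGroup` for its description as a Fourier multiplier. -/
def freeGroup (t : ℝ) (f : ℝ → ℝ × ℝ) (y : ℝ) : ℝ × ℝ :=
  ((((f (y + t)).1 + (f (y + t)).2) + ((f (y - t)).1 - (f (y - t)).2)) / 2,
    (((f (y + t)).1 + (f (y + t)).2) - ((f (y - t)).1 - (f (y - t)).2)) / 2)

/-- The Fourier transform, componentwise, of a function with values in `ℝ²`. -/
def fourierVec (f : ℝ → ℝ × ℝ) (ξ : ℝ) : Fin 2 → ℂ :=
  ![𝓕 (fun y => ((f y).1 : ℂ)) ξ, 𝓕 (fun y => ((f y).2 : ℂ)) ξ]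

theorem fourier_translate (f : ℝ → ℂ) (a ξ : ℝ) :
    𝓕 (fun y => f (y + a)) ξ = Complex.exp (2 * Real.pi * ξ * a * Complex.I) * 𝓕 f ξ := by
  rw [Real.fourier_real_eq_integral_exp_smul, Real.fourier_real_eq_integral_exp_smul,
    ← integral_const_mul,
    ← integral_add_right_eq_self (fun y : ℝ => Complex.exp (2 * Real.pi * ξ * a * Complex.I) *
      Complex.exp (↑(-2 * Real.pi * y * ξ) * Complex.I) • f y) a]
  congr 1 with y
  rw [smul_eq_mul, smul_eq_mul, ← mul_assoc, ← Complex.exp_add]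
  congr 2
  push_cast
  ring

theorem exp_smul_swap (z : ℂ) :
    NormedSpace.exp (z • !![(0 : ℂ), 1; 1, 0]) =
      !![(Complex.exp z + Complex.exp (-z)) / 2, (Complex.exp z - Complex.exp (-z)) / 2;
        (Complex.exp z - Complex.exp (-z)) / 2, (Complex.exp z + Complex.exp (-z)) / 2] := by
  have hdet : (!![(1 : ℂ), 1; 1, -1]).det = -2 := by
    rw [Matrix.det_fin_two_of]; norm_num
  have hu : IsUnit !![(1 : ℂ), 1; 1, -1] := by
    rw [Matrix.isUnit_iff_isUnit_det, hdet]
    exact isUnit_iff_ne_zero.mpr (by norm_num)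
  have hinv : (!![(1 : ℂ), 1; 1, -1])⁻¹ = !![(1 / 2 : ℂ), 1 / 2; 1 / 2, -1 / 2] := by
    apply Matrix.inv_eq_right_inv
    ext i j
    fin_cases i <;> fin_cases j <;> norm_num [Matrix.mul_apply, Fin.sum_univ_two]
  have h : z • !![(0 : ℂ), 1; 1, 0] =
      !![(1 : ℂ), 1; 1, -1] * Matrix.diagonal ![z, -z] * (!![(1 : ℂ), 1; 1, -1])⁻¹ := by
    rw [hinv]
    ext i j
    fin_cases i <;> fin_cases j <;>
      simp [Matrix.mul_apply, Fin.sum_univ_two, Matrix.diagonal_apply,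
        -Matrix.cons_mul] <;> ring
  rw [h, Matrix.exp_conj _ _ hu, Matrix.exp_diagonal, hinv]
  ext i j
  fin_cases i <;> fin_cases j <;>
    simp [Matrix.mul_apply, Fin.sum_univ_two, Matrix.diagonal_apply, -Matrix.cons_mul, Pi.coe_exp,
      ← Complex.exp_eq_exp_ℂ] <;> ring

/-- `(T(t) f)^(k) = exp (i k t σ₁) f^(k)`, where the wave number is `k = 2πξ` in terms of the
frequency `ξ` used by the Fourier transform of the library. -/
theorem fourierVec_freeGroup (t : ℝ) (f : ℝ → ℝ × ℝ) (hf : Integrable f) (ξ : ℝ) :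
    fourierVec (freeGroup t f) ξ =
      (NormedSpace.exp ((2 * Real.pi * ξ * t * Complex.I) • !![(0 : ℂ), 1; 1, 0])).mulVec
        (fourierVec f ξ) := by
  have h1 : Integrable (fun y => ((f y).1 : ℂ)) := hf.fst.ofReal
  have h2 : Integrable (fun y => ((f y).2 : ℂ)) := hf.snd.ofReal
  have key : ∀ a b c d : ℂ, 𝓕 (fun y => a * ((f (y + t)).1 : ℂ) + b * ((f (y + t)).2 : ℂ) +
      c * ((f (y + -t)).1 : ℂ) + d * ((f (y + -t)).2 : ℂ)) ξ =
      Complex.exp (2 * Real.pi * ξ * t * Complex.I) *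
        (a * 𝓕 (fun y => ((f y).1 : ℂ)) ξ + b * 𝓕 (fun y => ((f y).2 : ℂ)) ξ) +
      Complex.exp (-(2 * Real.pi * ξ * t * Complex.I)) *
        (c * 𝓕 (fun y => ((f y).1 : ℂ)) ξ + d * 𝓕 (fun y => ((f y).2 : ℂ)) ξ) := by
    intro a b c d
    have e1 := fourier_translate (fun y => ((f y).1 : ℂ)) t ξ
    have e2 := fourier_translate (fun y => ((f y).2 : ℂ)) t ξ
    have e3 := fourier_translate (fun y => ((f y).1 : ℂ)) (-t) ξ
    have e4 := fourier_translate (fun y => ((f y).2 : ℂ)) (-t) ξ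
    have hs : (2 * Real.pi * ξ * ((-t : ℝ) : ℂ) * Complex.I : ℂ) =
        -(2 * Real.pi * ξ * t * Complex.I) := by push_cast; ring
    rw [hs] at e3 e4
    have i1 := (Real.fourierIntegral_convergent_iff ξ).2 (h1.comp_add_right t)
    have i2 := (Real.fourierIntegral_convergent_iff ξ).2 (h2.comp_add_right t)
    have i3 := (Real.fourierIntegral_convergent_iff ξ).2 (h1.comp_add_right (-t))
    have i4 := (Real.fourierIntegral_convergent_iff ξ).2 (h2.comp_add_right (-t))
    have hsum : 𝓕 (fun y => a * ((f (y + t)).1 : ℂ) + b * ((f (y + t)).2 : ℂ) +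
        c * ((f (y + -t)).1 : ℂ) + d * ((f (y + -t)).2 : ℂ)) ξ =
        a * 𝓕 (fun y => ((f (y + t)).1 : ℂ)) ξ + b * 𝓕 (fun y => ((f (y + t)).2 : ℂ)) ξ +
        c * 𝓕 (fun y => ((f (y + -t)).1 : ℂ)) ξ + d * 𝓕 (fun y => ((f (y + -t)).2 : ℂ)) ξ := by
      simp only [Real.fourier_eq, ← integral_const_mul]
      rw [← integral_add, ← integral_add, ← integral_add]
      · congr 1 with y
        simp only [Circle.smul_def, smul_eq_mul]
        ring
      · exact ((i1.const_mul a).add (i2.const_mul b)).add (i3.const_mul c)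
      · exact i4.const_mul d
      · exact (i1.const_mul a).add (i2.const_mul b)
      · exact i3.const_mul c
      · exact i1.const_mul a
      · exact i2.const_mul b
    rw [hsum, e1, e2, e3, e4]
    ring
  have k1 := key (1 / 2) (1 / 2) (1 / 2) (-1 / 2)
  have k2 := key (1 / 2) (1 / 2) (-1 / 2) (1 / 2)
  have r1 : (fun y => ((freeGroup t f y).1 : ℂ)) = fun y => 1 / 2 * ((f (y + t)).1 : ℂ) +
      1 / 2 * ((f (y + t)).2 : ℂ) + 1 / 2 * ((f (y + -t)).1 : ℂ) +
      -1 / 2 * ((f (y + -t)).2 : ℂ) := by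
    ext y; simp only [freeGroup, sub_eq_add_neg]; push_cast; ring
  have r2 : (fun y => ((freeGroup t f y).2 : ℂ)) = fun y => 1 / 2 * ((f (y + t)).1 : ℂ) +
      1 / 2 * ((f (y + t)).2 : ℂ) + -1 / 2 * ((f (y + -t)).1 : ℂ) +
      1 / 2 * ((f (y + -t)).2 : ℂ) := by
    ext y; simp only [freeGroup, sub_eq_add_neg]; push_cast; ring
  rw [exp_smul_swap]
  unfold fourierVec
  rw [r1, r2, k1, k2]
  ext i
  fin_cases i <;> simp [Matrix.mulVec, dotProduct, Fin.sum_univ_two] <;> ring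

/-- `B`, written as `B t y`, is a global mild solution, with values in `H¹`, of the initial value
problem for the perturbation system in the lab frame with initial data `B₀`:
`B ∈ C([0, ∞); H¹)` and `B(t) = T(t) B₀ + ∫₀ᵗ T(t - s) N_*(s, B(s)) ds` for `t ≥ 0`. -/
structure IsMildSolution (N : ℝ → ℝ) (c : ℝ) (b : ℝ → ℝ × ℝ) (B₀ : ℝ → ℝ × ℝ)
    (B : ℝ → ℝ → ℝ × ℝ) : Prop where
  continuous_H1 : ContinuousOnInH1 B (Ici 0)
  initial : B 0 = B₀
  duhamel : ∀ t : ℝ, 0 ≤ t → ∀ y : ℝ,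
    B t y = freeGroup t B₀ y +
      ∫ s in (0 : ℝ)..t, freeGroup (t - s) (fun z => labNonlinearity N c b z s (B s z)) y

/-- The domain of dependence `Δ(y₀, t₀)` of the space-time point `(y₀, t₀)`. -/
def domainOfDependence (y₀ t₀ : ℝ) : Set (ℝ × ℝ) :=
  {p | |p.1 - y₀| ≤ t₀ - p.2 ∧ 0 ≤ p.2 ∧ p.2 ≤ t₀}

/-- A function `B t y` of the lab frame written in the frame moving with speed `c`, whose spatial
coordinate is `x = y - c t`. -/
def inMovingFrame (c : ℝ) (B : ℝ → ℝ → ℝ × ℝ) (t x : ℝ) : ℝ × ℝ := B t (x + c * t)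

end PulseStability

end

noncomputable section

namespace PulseStability

/-! ### The Sobolev embedding of `H¹(ℝ)` -/

/-! The principal part moves information along the characteristics `y ± t` only: the free group at
time `t` and point `y` reads its argument at `y + t` and `y - t`. In Duhamel's formula at `(y, t)`,
the integrand at time `s` therefore samples the solution at `y ± (t - s)`, and these points stay in
the domain of dependence whenever `(y, t)` lies in it. For two solutions with equal data on the
base, the free terms cancel there and only the difference of the lower order terms remains.

Both solutions are jointly continuous in time and space, by the Sobolev embedding
(`enorm_le_eLpNorm_add_eLpNorm`), hence bounded on a compact rectangle containing the domain. The
lower order terms are smooth, so on that rectangle they are Lipschitz in the perturbation with some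
constant `L` (`exists_norm_labNonlinearity_sub_le`). Iterating Duhamel's formula `n` times bounds
the difference by `M * (2 * L * t) ^ n / n!`, which tends to `0` (`IsMildSolution.eq_of_eqOn_Icc`).

Statement 1 is the comparison with the zero solution. Statement 3 applies the comparison to the
domain of dependence with apex at the given point. -/

/-- The primitive of a normalized bump function of radius at most `1`. -/
def bumpPrimitive {x : ℝ} (η : ContDiffBump x) (y : ℝ) : ℝ := ∫ u in Iic y, η.normed volume u

section bump

variable {x : ℝ} (η : ContDiffBump x)

theorem hasDerivAt_bumpPrimitive (y : ℝ) :
    HasDerivAt (bumpPrimitive η) (η.normed volume y) y := by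
  have hi := η.integrable_normed (μ := volume)
  have h : bumpPrimitive η = fun z => bumpPrimitive η x + ∫ u in x..z, η.normed volume u := by
    ext z
    rw [← intervalIntegral.integral_Iic_sub_Iic hi.integrableOn hi.integrableOn]
    simp only [bumpPrimitive]
    ring
  rw [h]
  exact (intervalIntegral.integral_hasDerivAt_right hi.intervalIntegrable
    (η.continuous_normed.stronglyMeasurableAtFilter _ _) η.continuous_normed.continuousAt).const_add _

theorem contDiff_bumpPrimitive : ContDiff ℝ ∞ (bumpPrimitive η) := by
  rw [contDiff_infty_iff_deriv]
  refine ⟨fun y => (hasDerivAt_bumpPrimitive η y).differentiableAt, ?_⟩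
  rw [funext fun y => (hasDerivAt_bumpPrimitive η y).deriv]
  exact η.contDiff_normed

theorem bumpPrimitive_nonneg (y : ℝ) : 0 ≤ bumpPrimitive η y :=
  integral_nonneg fun u => η.nonneg_normed u

theorem bumpPrimitive_le_one (y : ℝ) : bumpPrimitive η y ≤ 1 := by
  rw [← η.integral_normed (μ := volume)]
  exact setIntegral_le_integral η.integrable_normed (ae_of_all _ fun u => η.nonneg_normed u)

theorem normed_eq_zero_of_notMem (hη : η.rOut ≤ 1) {y : ℝ} (hy : 1 < |y - x|) :
    η.normed volume y = 0 := by
  rw [← Function.notMem_support, η.support_normed_eq, Metric.mem_ball, Real.dist_eq]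
  linarith

theorem bumpPrimitive_eq_zero (hη : η.rOut ≤ 1) {y : ℝ} (hy : y < x - 1) :
    bumpPrimitive η y = 0 := by
  refine setIntegral_eq_zero_of_forall_eq_zero fun u hu => normed_eq_zero_of_notMem η hη ?_
  rw [lt_abs]
  right
  linarith [mem_Iic.1 hu]

theorem bumpPrimitive_eq_one (hη : η.rOut ≤ 1) {y : ℝ} (hy : x + 1 < y) :
    bumpPrimitive η y = 1 := by
  rw [← η.integral_normed (μ := volume)]
  refine setIntegral_eq_integral_of_forall_compl_eq_zero fun u hu =>
    normed_eq_zero_of_notMem η hη ?_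
  rw [lt_abs]
  left
  linarith [not_le.1 (mt mem_Iic.2 hu)]

end bump

/-- Hölder's inequality on the interval of radius `1` about `x`, which has length `2`. The sharp
factor `2 ^ (1 / 2)` is rounded up to `2`. -/
theorem enorm_integral_smul_le_eLpNorm {E : Type*} [NormedAddCommGroup E] [NormedSpace ℝ E]
    {ψ : ℝ → ℝ} {h : ℝ → E} {x : ℝ} (hψ : ∀ y, |ψ y| ≤ 1)
    (hψ0 : ∀ y, 1 < |y - x| → ψ y = 0) (hh : AEStronglyMeasurable h) :
    ‖∫ y, ψ y • h y‖ₑ ≤ 2 * eLpNorm h 2 := by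
  have hs : ∫ y, ψ y • h y = ∫ y in Metric.closedBall x 1, ψ y • h y := by
    refine (setIntegral_eq_integral_of_forall_compl_eq_zero fun y hy => ?_).symm
    rw [hψ0 y, zero_smul]
    rwa [Metric.mem_closedBall, Real.dist_eq, not_le] at hy
  have hvol : (volume.restrict (Metric.closedBall x 1)) univ = 2 := by
    rw [Measure.restrict_apply_univ, Real.volume_closedBall]
    norm_num
  have h1 : ‖∫ y in Metric.closedBall x 1, ψ y • h y‖ₑ ≤
      eLpNorm h 1 (volume.restrict (Metric.closedBall x 1)) := by
    rw [eLpNorm_one_eq_lintegral_enorm]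
    refine (enorm_integral_le_lintegral_enorm _).trans (lintegral_mono fun y => ?_)
    rw [enorm_le_iff_norm_le, norm_smul, Real.norm_eq_abs]
    exact mul_le_of_le_one_left (norm_nonneg _) (hψ y)
  have h2 : eLpNorm h 1 (volume.restrict (Metric.closedBall x 1)) ≤
      eLpNorm h 2 (volume.restrict (Metric.closedBall x 1)) *
        2 ^ (1 / (1 : ENNReal).toReal - 1 / (2 : ENNReal).toReal) := by
    rw [← hvol]
    exact eLpNorm_le_eLpNorm_mul_rpow_measure_univ (by norm_num) hh.restrict
  have h3 : (2 : ENNReal) ^ (1 / (1 : ENNReal).toReal - 1 / (2 : ENNReal).toReal) ≤ 2 := by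
    conv_rhs => rw [← ENNReal.rpow_one 2]
    exact ENNReal.rpow_le_rpow_of_exponent_le (by norm_num) (by norm_num)
  have h4 : eLpNorm h 2 (volume.restrict (Metric.closedBall x 1)) ≤ eLpNorm h 2 :=
    eLpNorm_mono_measure h Measure.restrict_le_self
  rw [hs, mul_comm]
  exact h1.trans (h2.trans (mul_le_mul' h4 h3))

/-- A unit bump function, whose normalization is bounded by `1`. -/
def unitBump (x : ℝ) : ContDiffBump x := ⟨1 / 2, 1, by norm_num, by norm_num⟩

theorem unitBump_normed_le_one (x y : ℝ) : (unitBump x).normed volume y ≤ 1 := by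
  -- The argument `2` is the ratio of outer to inner radius; divided by the length `2` of the
  -- support it gives the bound `1`.
  have h := (unitBump x).normed_le_div_measure_closedBall_rOut volume 2
    (by norm_num [unitBump]) y
  have hv : volume.real (Metric.closedBall x (unitBump x).rOut) = 2 := by
    rw [Real.volume_real_closedBall (unitBump x).rOut_pos.le]
    norm_num [unitBump]
  rw [hv] at h
  simpa using h

/-- The difference of the two primitives is an admissible test function: both vanish far to the left
and equal `1` far to the right. This trades an average over an arbitrarily narrow bump for one over
a fixed bump, at the cost of a term in the weak derivative. -/
theorem integral_bump_smul_eq {f g : ℝ → ℝ × ℝ} (hfg : HasWeakDeriv f g) {x : ℝ}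
    (η χ : ContDiffBump x) (hη : η.rOut ≤ 1) (hχ : χ.rOut ≤ 1) :
    ∫ y, η.normed volume y • f y = (∫ y, χ.normed volume y • f y) -
      ∫ y, (bumpPrimitive η y - bumpPrimitive χ y) • g y := by
  have hd : deriv (fun y => bumpPrimitive η y - bumpPrimitive χ y) =
      fun y => η.normed volume y - χ.normed volume y := funext fun y =>
    ((hasDerivAt_bumpPrimitive η y).sub (hasDerivAt_bumpPrimitive χ y)).deriv
  have hK : HasCompactSupport (fun y => bumpPrimitive η y - bumpPrimitive χ y) := by
    refine HasCompactSupport.intro (isCompact_closedBall x 1) fun y hy => ?_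
    rw [Metric.mem_closedBall, Real.dist_eq, not_le, lt_abs] at hy
    rcases hy with hy | hy
    · rw [bumpPrimitive_eq_one η hη (by linarith), bumpPrimitive_eq_one χ hχ (by linarith),
        sub_self]
    · rw [bumpPrimitive_eq_zero η hη (by linarith), bumpPrimitive_eq_zero χ hχ (by linarith),
        sub_self]
  have h := hfg.2.2 _ ((contDiff_bumpPrimitive η).sub (contDiff_bumpPrimitive χ)) hK
  have hi (θ : ContDiffBump x) : Integrable (fun y => θ.normed volume y • f y) :=
    hfg.1.integrable_smul_left_of_hasCompactSupport θ.continuous_normed θ.hasCompactSupport_normed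
  rw [hd] at h
  simp only [sub_smul _ _ (f _)] at h
  rw [integral_sub (hi η) (hi χ)] at h
  rw [sub_eq_iff_eq_add] at h
  rw [h]
  abel

/-- The Sobolev inequality on the line. -/
theorem enorm_le_eLpNorm_add_eLpNorm {f g : ℝ → ℝ × ℝ} (hf : Continuous f)
    (hfg : HasWeakDeriv f g) (x : ℝ) : ‖f x‖ₑ ≤ 2 * (eLpNorm f 2 + eLpNorm g 2) := by
  -- This bound is uniform in the width of `η`, so it survives shrinking `η` to the point `x`.
  have hbound (η : ContDiffBump x) (hη : η.rOut ≤ 1) :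
      ‖∫ y, η.normed volume y • f y‖ₑ ≤ 2 * (eLpNorm f 2 + eLpNorm g 2) := by
    rw [integral_bump_smul_eq hfg η (unitBump x) hη le_rfl, mul_add]
    refine enorm_sub_le.trans (add_le_add ?_ ?_)
    · refine enorm_integral_smul_le_eLpNorm (fun y => ?_)
        (fun y hy => normed_eq_zero_of_notMem (unitBump x) le_rfl hy) hf.aestronglyMeasurable
      rw [abs_of_nonneg ((unitBump x).nonneg_normed y)]
      exact unitBump_normed_le_one x y
    · refine enorm_integral_smul_le_eLpNorm (x := x) (fun y => ?_) (fun y hy => ?_)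
        hfg.2.1.aestronglyMeasurable
      · have h1 := bumpPrimitive_nonneg η y
        have h2 := bumpPrimitive_le_one η y
        have h3 := bumpPrimitive_nonneg (unitBump x) y
        have h4 := bumpPrimitive_le_one (unitBump x) y
        rw [abs_le]
        constructor <;> linarith
      · rcases lt_abs.1 hy with hy | hy
        · rw [bumpPrimitive_eq_one η hη (by linarith),
            bumpPrimitive_eq_one (unitBump x) le_rfl (by linarith), sub_self]
        · rw [bumpPrimitive_eq_zero η hη (by linarith),
            bumpPrimitive_eq_zero (unitBump x) le_rfl (by linarith), sub_self]
  have happrox (ε : ℝ) (hε : 0 < ε) : ∃ η : ContDiffBump x, η.rOut ≤ 1 ∧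
      ‖f x - ∫ y, η.normed volume y • f y‖ ≤ ε := by
    obtain ⟨δ, hδ, hfδ⟩ := Metric.continuous_iff.1 hf x ε hε
    have hm : 0 < min δ 1 := lt_min hδ one_pos
    let η : ContDiffBump x := ⟨min δ 1 / 2, min δ 1, by linarith, by linarith⟩
    refine ⟨η, min_le_right _ _, ?_⟩
    have hi : Integrable (fun y => η.normed volume y • f y) :=
      hfg.1.integrable_smul_left_of_hasCompactSupport η.continuous_normed
        η.hasCompactSupport_normed
    have hc : Integrable (fun y => η.normed volume y • f x) :=
      η.integrable_normed.smul_const _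
    conv_lhs => rw [← η.integral_normed_smul (μ := volume) (f x), ← integral_sub hc hi]
    calc ‖∫ y, (η.normed volume y • f x - η.normed volume y • f y)‖
        ≤ ∫ y, η.normed volume y * ε := by
          refine norm_integral_le_of_norm_le (η.integrable_normed.mul_const _)
            (ae_of_all _ fun y => ?_)
          rw [← smul_sub, norm_smul, Real.norm_eq_abs, abs_of_nonneg (η.nonneg_normed y)]
          by_cases hy : y ∈ Metric.ball x η.rOut
          · refine mul_le_mul_of_nonneg_left ?_ (η.nonneg_normed y)
            rw [← dist_eq_norm, dist_comm]
            exact (hfδ y ((Metric.mem_ball.1 hy).trans_le (min_le_left _ _))).le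
          · rw [← η.support_normed_eq (μ := volume), Function.notMem_support] at hy
            simp [hy]
      _ = ε := by rw [integral_mul_const, η.integral_normed, one_mul]
  refine ENNReal.le_of_forall_pos_le_add fun ε hε _ => ?_
  obtain ⟨η, hη, h⟩ := happrox ε hε
  calc ‖f x‖ₑ = ‖(∫ y, η.normed volume y • f y) + (f x - ∫ y, η.normed volume y • f y)‖ₑ := by
        rw [add_sub_cancel]
    _ ≤ _ := (enorm_add_le _ _).trans (add_le_add (hbound η hη) (by
        rw [← ofReal_norm, ← ENNReal.ofReal_coe_nnreal]
        exact ENNReal.ofReal_le_ofReal h))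

theorem HasWeakDeriv.sub {f₁ g₁ f₂ g₂ : ℝ → ℝ × ℝ} (h₁ : HasWeakDeriv f₁ g₁)
    (h₂ : HasWeakDeriv f₂ g₂) : HasWeakDeriv (f₁ - f₂) (g₁ - g₂) := by
  refine ⟨h₁.1.sub h₂.1, h₁.2.1.sub h₂.2.1, fun φ hφ hc => ?_⟩
  have hi {f : ℝ → ℝ × ℝ} (hf : LocallyIntegrable f) : Integrable (fun y => deriv φ y • f y) :=
    hf.integrable_smul_left_of_hasCompactSupport (hφ.continuous_deriv (by simp)) hc.deriv
  have hj {f : ℝ → ℝ × ℝ} (hf : LocallyIntegrable f) : Integrable (fun y => φ y • f y) :=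
    hf.integrable_smul_left_of_hasCompactSupport hφ.continuous hc
  simp only [Pi.sub_apply, smul_sub]
  rw [integral_sub (hi h₁.1) (hi h₂.1), integral_sub (hj h₁.2.1) (hj h₂.2.1),
    h₁.2.2 φ hφ hc, h₂.2.2 φ hφ hc]
  abel

/-- A continuous curve in `H¹(ℝ)` is a continuous function of time and space. -/
theorem ContinuousOnInH1.continuousOn_uncurry {B : ℝ → ℝ → ℝ × ℝ} {S : Set ℝ}
    (hB : ContinuousOnInH1 B S) :
    ContinuousOn (fun p : ℝ × ℝ => B p.1 p.2) (S ×ˢ univ) := by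
  obtain ⟨G, hG, hlim⟩ := hB
  rintro ⟨t₀, y₀⟩ ⟨ht₀, -⟩
  have hlim' : Tendsto (fun t => 2 * (eLpNorm (B t - B t₀) 2 volume +
      eLpNorm (G t - G t₀) 2 volume)) (𝓝[S] t₀) (𝓝 0) := by
    simpa using ENNReal.Tendsto.const_mul (a := 2) (hlim t₀ ht₀) (Or.inr (by norm_num))
  rw [Metric.continuousWithinAt_iff']
  intro ε hε
  -- The Sobolev inequality for `B t - B t₀` makes the convergence uniform in `y`; joint continuity
  -- then follows from continuity of the single slice `B t₀`.
  have h1 : ∀ᶠ t in 𝓝[S] t₀, ∀ y, ‖B t y - B t₀ y‖ < ε / 2 := by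
    have hpos : (0 : ENNReal) < ENNReal.ofReal (ε / 2) := by simpa using hε
    filter_upwards [hlim'.eventually (gt_mem_nhds hpos), self_mem_nhdsWithin] with t ht htS y
    have h := enorm_le_eLpNorm_add_eLpNorm ((hG t htS).1.sub (hG t₀ ht₀).1)
      ((hG t htS).2.2.2.sub (hG t₀ ht₀).2.2.2) y
    have h' := h.trans_lt ht
    rw [← ofReal_norm, ENNReal.ofReal_lt_ofReal_iff (by linarith)] at h'
    exact h'
  have h2 : ∀ᶠ y in 𝓝 y₀, ‖B t₀ y - B t₀ y₀‖ < ε / 2 := by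
    have h := Metric.tendsto_nhds.1 ((hG t₀ ht₀).1.tendsto y₀) (ε / 2) (by linarith)
    simpa only [dist_eq_norm] using h
  rw [nhdsWithin_prod_eq, nhdsWithin_univ]
  filter_upwards [h1.prod_mk h2] with p hp
  rw [dist_eq_norm]
  calc ‖B p.1 p.2 - B t₀ y₀‖ = ‖(B p.1 p.2 - B t₀ p.2) + (B t₀ p.2 - B t₀ y₀)‖ := by
        rw [sub_add_sub_cancel]
    _ ≤ ‖B p.1 p.2 - B t₀ p.2‖ + ‖B t₀ p.2 - B t₀ y₀‖ := norm_add_le _ _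
    _ < ε := by linarith [hp.1 p.2, hp.2]

/-! ### The lower order terms -/

/-- The lower order terms as a function of the values of the traveling wave and of the
perturbation. -/
def reaction (N : ℝ → ℝ) (p : (ℝ × ℝ) × (ℝ × ℝ)) : ℝ × ℝ :=
  (N (normSq (p.1 + p.2)) * p.2.2 + (N (normSq (p.1 + p.2)) - N (normSq p.1)) * p.1.2,
    -N (normSq (p.1 + p.2)) * p.2.1 - (N (normSq (p.1 + p.2)) - N (normSq p.1)) * p.1.1)

theorem labNonlinearity_eq_reaction (N : ℝ → ℝ) (c : ℝ) (b : ℝ → ℝ × ℝ) (y t : ℝ) (B : ℝ × ℝ) :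
    labNonlinearity N c b y t B = reaction N (b (y - c * t), B) := rfl

/-- Smoothness of `N` on `[0, ∞)` alone suffices, because `normSq` takes no negative values. -/
theorem IsSaturableNonlinearity.contDiff_comp_normSq {N : ℝ → ℝ}
    (hN : IsSaturableNonlinearity N) : ContDiff ℝ ∞ (fun b => N (normSq b)) := by
  have h : ContDiff ℝ ∞ normSq := by unfold normSq; fun_prop
  rw [← contDiffOn_univ]
  exact hN.smooth.comp h.contDiffOn fun b _ => add_nonneg (sq_nonneg b.1) (sq_nonneg b.2)

theorem IsSaturableNonlinearity.contDiff_reaction {N : ℝ → ℝ}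
    (hN : IsSaturableNonlinearity N) : ContDiff ℝ ∞ (reaction N) := by
  have h1 : ContDiff ℝ ∞ (fun p : (ℝ × ℝ) × (ℝ × ℝ) => N (normSq (p.1 + p.2))) :=
    hN.contDiff_comp_normSq.comp (contDiff_fst.add contDiff_snd)
  have h2 : ContDiff ℝ ∞ (fun p : (ℝ × ℝ) × (ℝ × ℝ) => N (normSq p.1)) :=
    hN.contDiff_comp_normSq.comp contDiff_fst
  have hu : ContDiff ℝ ∞ (fun p : (ℝ × ℝ) × (ℝ × ℝ) => p.1.1) := contDiff_fst.fst
  have hv : ContDiff ℝ ∞ (fun p : (ℝ × ℝ) × (ℝ × ℝ) => p.1.2) := contDiff_fst.snd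
  have hU : ContDiff ℝ ∞ (fun p : (ℝ × ℝ) × (ℝ × ℝ) => p.2.1) := contDiff_snd.fst
  have hV : ContDiff ℝ ∞ (fun p : (ℝ × ℝ) × (ℝ × ℝ) => p.2.2) := contDiff_snd.snd
  exact ((h1.mul hV).add ((h1.sub h2).mul hv)).prodMk ((h1.neg.mul hU).sub ((h1.sub h2).mul hu))

theorem IsTravelingWave.continuous {N : ℝ → ℝ} {c : ℝ} {b : ℝ → ℝ × ℝ}
    (hb : IsTravelingWave N c b) : Continuous b :=
  (continuous_iff_continuousAt.2 fun x => (hb.ode_fst x).continuousAt).prodMk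
    (continuous_iff_continuousAt.2 fun x => (hb.ode_snd x).continuousAt)

theorem labNonlinearity_zero (N : ℝ → ℝ) (c : ℝ) (b : ℝ → ℝ × ℝ) (y t : ℝ) :
    labNonlinearity N c b y t 0 = 0 := by
  simp [labNonlinearity]

/-! ### The free group -/

theorem freeGroup_sub (t : ℝ) (f g : ℝ → ℝ × ℝ) (y : ℝ) :
    freeGroup t (fun z => f z - g z) y = freeGroup t f y - freeGroup t g y := by
  simp only [freeGroup, Prod.fst_sub, Prod.snd_sub, Prod.mk_sub_mk]
  ext <;> ring

/-- In the sup norm of `ℝ × ℝ`, each component is half a signed sum of the four components of the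
two sampled values. -/
theorem norm_freeGroup_le (t : ℝ) (f : ℝ → ℝ × ℝ) (y : ℝ) :
    ‖freeGroup t f y‖ ≤ ‖f (y + t)‖ + ‖f (y - t)‖ := by
  have h1 := abs_le.1 (norm_fst_le (f (y + t)))
  have h2 := abs_le.1 (norm_snd_le (f (y + t)))
  have h3 := abs_le.1 (norm_fst_le (f (y - t)))
  have h4 := abs_le.1 (norm_snd_le (f (y - t)))
  refine max_le ?_ ?_ <;> refine abs_le.2 ⟨?_, ?_⟩ <;> simp only [freeGroup] <;> linarith

/-! ### Mild solutions -/

section mild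

variable {N : ℝ → ℝ} {c : ℝ} {b : ℝ → ℝ × ℝ} {B₀ : ℝ → ℝ × ℝ} {B : ℝ → ℝ → ℝ × ℝ}

theorem isMildSolution_zero (N : ℝ → ℝ) (c : ℝ) (b : ℝ → ℝ × ℝ) :
    IsMildSolution N c b 0 0 where
  continuous_H1 := by
    refine ⟨0, fun t _ => ⟨continuous_const, MemLp.zero, MemLp.zero, locallyIntegrable_zero,
      locallyIntegrable_zero, fun φ _ _ => by simp⟩,
      fun t _ => by simpa using tendsto_const_nhds⟩
  initial := rfl
  duhamel t _ y := by simp [labNonlinearity_zero, freeGroup, Prod.ext_iff]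

/-- Supplies the integrability needed to subtract two Duhamel integrals under one integral sign. -/
theorem IsMildSolution.continuousOn_duhamel_integrand (hN : IsSaturableNonlinearity N)
    (hb : Continuous b) (hB : IsMildSolution N c b B₀ B) (t y : ℝ) :
    ContinuousOn (fun s => freeGroup (t - s) (fun z => labNonlinearity N c b z s (B s z)) y)
      (Ici 0) := by
  have hF {γ : ℝ → ℝ} (hγ : Continuous γ) :
      ContinuousOn (fun s => labNonlinearity N c b (γ s) s (B s (γ s))) (Ici 0) := by
    have hBγ : ContinuousOn (fun s => B s (γ s)) (Ici 0) :=
      hB.continuous_H1.continuousOn_uncurry.comp (f := fun s => (s, γ s))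
        (continuous_id.prodMk hγ).continuousOn fun s hs => ⟨hs, mem_univ _⟩
    have hbγ : Continuous (fun s => b (γ s - c * s)) := hb.comp (by fun_prop)
    simp only [labNonlinearity_eq_reaction]
    exact hN.contDiff_reaction.continuous.comp_continuousOn (hbγ.continuousOn.prodMk hBγ)
  have h1 := hF (γ := fun s => y + (t - s)) (by fun_prop)
  have h2 := hF (γ := fun s => y - (t - s)) (by fun_prop)
  unfold freeGroup
  exact ((((h1.fst.add h1.snd).add (h2.fst.sub h2.snd)).div_const 2).prodMk
    (((h1.fst.add h1.snd).sub (h2.fst.sub h2.snd)).div_const 2))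

/-- Continuous functions with values in a common bounded set have lower order terms whose
difference is controlled by the difference of the functions. -/
theorem exists_norm_labNonlinearity_sub_le (hN : IsSaturableNonlinearity N) (hb : Continuous b)
    {A B : ℝ → ℝ → ℝ × ℝ} {K : Set (ℝ × ℝ)} (hK : IsCompact K)
    (hA : ContinuousOn (fun p : ℝ × ℝ => A p.1 p.2) K)
    (hB : ContinuousOn (fun p : ℝ × ℝ => B p.1 p.2) K) :
    ∃ L M : ℝ, 0 ≤ L ∧ ∀ s z, (s, z) ∈ K → ‖B s z - A s z‖ ≤ M ∧
      ‖labNonlinearity N c b z s (B s z) - labNonlinearity N c b z s (A s z)‖ ≤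
        L * ‖B s z - A s z‖ := by
  have hβ : ContinuousOn (fun p : ℝ × ℝ => b (p.2 - c * p.1)) K :=
    (hb.comp (by fun_prop)).continuousOn
  have hA' := hβ.prodMk hA
  have hB' := hβ.prodMk hB
  -- The union of the two images is compact but need not be convex; a locally Lipschitz map is
  -- nevertheless Lipschitz on it.
  have hC := (hK.image_of_continuousOn hA').union (hK.image_of_continuousOn hB')
  obtain ⟨L, hL⟩ := ((hN.contDiff_reaction.of_le
    (by exact_mod_cast le_top : (1 : WithTop ℕ∞) ≤ ∞)).locallyLipschitz.locallyLipschitzOn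
      ).exists_lipschitzOnWith_of_compact hC
  obtain ⟨M, hM⟩ := hK.exists_bound_of_continuousOn (hB.sub hA)
  refine ⟨L, M, L.coe_nonneg, fun s z hsz => ⟨hM (s, z) hsz, ?_⟩⟩
  have h := hL.dist_le_mul _ (Or.inr (mem_image_of_mem _ hsz)) _ (Or.inl (mem_image_of_mem _ hsz))
  -- Both arguments carry the same wave value, so only the perturbations contribute to the distance.
  rw [dist_prod_same_left, dist_eq_norm, dist_eq_norm] at h
  exact h

/-- Solutions whose initial data agree on the base of a domain of dependence agree on it. -/
theorem IsMildSolution.eq_of_eqOn_Icc (hN : IsSaturableNonlinearity N) (hb : Continuous b)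
    {A₀ : ℝ → ℝ × ℝ} {A : ℝ → ℝ → ℝ × ℝ} (hA : IsMildSolution N c b A₀ A)
    (hB : IsMildSolution N c b B₀ B) {y₀ t₀ : ℝ}
    (h₀ : ∀ y ∈ Icc (y₀ - t₀) (y₀ + t₀), B₀ y = A₀ y) {y t : ℝ} (ht : 0 ≤ t)
    (hy : |y - y₀| ≤ t₀ - t) : B t y = A t y := by
  have hsub : Icc 0 t₀ ×ˢ Icc (y₀ - t₀) (y₀ + t₀) ⊆ Ici (0 : ℝ) ×ˢ univ :=
    prod_mono (fun s hs => hs.1) (subset_univ _)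
  obtain ⟨L, M, hL, hLM⟩ := exists_norm_labNonlinearity_sub_le (c := c) hN hb
    (isCompact_Icc.prod isCompact_Icc) (hA.continuous_H1.continuousOn_uncurry.mono hsub)
    (hB.continuous_H1.continuousOn_uncurry.mono hsub)
  have hmem {s z : ℝ} (hs : 0 ≤ s) (hz : |z - y₀| ≤ t₀ - s) :
      (s, z) ∈ Icc 0 t₀ ×ˢ Icc (y₀ - t₀) (y₀ + t₀) := by
    have h := abs_nonneg (z - y₀)
    have h' := abs_le.1 hz
    exact ⟨⟨hs, by linarith⟩, ⟨by linarith [h'.1], by linarith [h'.2]⟩⟩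
  -- Picard iteration: `M` starts the induction, and each pass through Duhamel's formula contributes
  -- `2 * L`, one `L` per characteristic, and an integration in time.
  have key (n : ℕ) : ∀ t y : ℝ, 0 ≤ t → |y - y₀| ≤ t₀ - t →
      ‖B t y - A t y‖ ≤ M * ((2 * L * t) ^ n / n.factorial) := by
    induction n with
    | zero =>
      intro t y ht hy
      simpa using (hLM t y (hmem ht hy)).1
    | succ n ih =>
      intro t y ht hy
      -- Backward characteristics from a point of the domain of dependence remain in it.
      have hcone {s : ℝ} (hs : s ∈ Icc 0 t) :
          |y + (t - s) - y₀| ≤ t₀ - s ∧ |y - (t - s) - y₀| ≤ t₀ - s := by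
        have h := abs_le.1 hy
        constructor <;> refine abs_le.2 ⟨?_, ?_⟩ <;> linarith [hs.1, hs.2, h.1, h.2]
      have hzero : freeGroup t B₀ y = freeGroup t A₀ y := by
        have h := hcone (left_mem_Icc.2 ht)
        rw [sub_zero] at h
        unfold freeGroup
        rw [h₀ _ (hmem le_rfl (by simpa using h.1)).2, h₀ _ (hmem le_rfl (by simpa using h.2)).2]
      have hint {C₀ : ℝ → ℝ × ℝ} {C : ℝ → ℝ → ℝ × ℝ} (hC : IsMildSolution N c b C₀ C) :
          IntervalIntegrable (fun s => freeGroup (t - s)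
            (fun z => labNonlinearity N c b z s (C s z)) y) volume 0 t := by
        refine ((hC.continuousOn_duhamel_integrand hN hb t y).mono ?_).intervalIntegrable
        rw [uIcc_of_le ht]
        exact fun s hs => hs.1
      rw [hB.duhamel t ht y, hA.duhamel t ht y, hzero, add_sub_add_left_eq_sub,
        ← intervalIntegral.integral_sub (hint hB) (hint hA)]
      calc _ ≤ ∫ s in (0 : ℝ)..t, 2 * L * M * (2 * L) ^ n / n.factorial * s ^ n := by
            refine intervalIntegral.norm_integral_le_of_norm_le ht (ae_of_all _ fun s hs => ?_)
              ((continuous_pow n).const_mul _ |>.intervalIntegrable _ _)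
            have hs' : s ∈ Icc 0 t := ⟨hs.1.le, hs.2⟩
            have hpt {z : ℝ} (hz : |z - y₀| ≤ t₀ - s) :
                ‖labNonlinearity N c b z s (B s z) - labNonlinearity N c b z s (A s z)‖ ≤
                  L * (M * ((2 * L * s) ^ n / n.factorial)) :=
              (hLM s z (hmem hs'.1 hz)).2.trans
                (mul_le_mul_of_nonneg_left (ih s z hs'.1 hz) hL)
            rw [← freeGroup_sub]
            refine (norm_freeGroup_le _ _ _).trans
              ((add_le_add (hpt (hcone hs').1) (hpt (hcone hs').2)).trans_eq ?_)
            rw [mul_pow]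
            ring
        _ = M * ((2 * L * t) ^ (n + 1) / (n + 1).factorial) := by
            rw [intervalIntegral.integral_const_mul, integral_pow, Nat.factorial_succ]
            push_cast
            field_simp
            ring
  have hlim : Tendsto (fun n : ℕ => M * ((2 * L * t) ^ n / n.factorial)) atTop (𝓝 0) := by
    simpa using (FloorSemiring.tendsto_pow_div_factorial_atTop (2 * L * t)).const_mul M
  have h := ge_of_tendsto' hlim fun n => key n t y ht hy
  exact sub_eq_zero.1 (norm_le_zero_iff.1 h)

end mild

end PulseStability

end

theorem mainTheorem3 (N : ℝ → ℝ) (hN : PulseStability.IsSaturableNonlinearity N)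
    (c : ℝ) (b : ℝ → ℝ × ℝ) (hb : PulseStability.IsTravelingWave N c b) :
    (∀ (y₀ t₀ : ℝ), 0 < t₀ →
      ∀ (B₀ : ℝ → ℝ × ℝ) (B : ℝ → ℝ → ℝ × ℝ), PulseStability.MemH1 B₀ →
        PulseStability.IsMildSolution N c b B₀ B →
        (∀ y ∈ Set.Icc (y₀ - t₀) (y₀ + t₀), B₀ y = 0) →
        ∀ y t : ℝ, (y, t) ∈ PulseStability.domainOfDependence y₀ t₀ → B t y = 0) ∧
    (∀ (y₀ t₀ : ℝ), 0 < t₀ →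
      ∀ (A₀ B₀ : ℝ → ℝ × ℝ) (A B : ℝ → ℝ → ℝ × ℝ),
        PulseStability.MemH1 A₀ → PulseStability.MemH1 B₀ →
        PulseStability.IsMildSolution N c b A₀ A → PulseStability.IsMildSolution N c b B₀ B →
        (∀ y ∈ Set.Icc (y₀ - t₀) (y₀ + t₀), B₀ y = A₀ y) →
        ∀ y t : ℝ, (y, t) ∈ PulseStability.domainOfDependence y₀ t₀ → B t y = A t y) ∧
    (∀ (ℓ : ℝ) (A₀ B₀ : ℝ → ℝ × ℝ) (A B : ℝ → ℝ → ℝ × ℝ),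
        PulseStability.MemH1 A₀ → PulseStability.MemH1 B₀ →
        PulseStability.IsMildSolution N c b A₀ A → PulseStability.IsMildSolution N c b B₀ B →
        (∀ y : ℝ, ℓ ≤ y → B₀ y = A₀ y) →
        (∀ y t : ℝ, 0 ≤ t → ℓ + t ≤ y → B t y = A t y) ∧
        (∀ x t : ℝ, 0 ≤ t → ℓ - (c - 1) * t ≤ x →
          PulseStability.inMovingFrame c B t x = PulseStability.inMovingFrame c A t x)) := by
  have hbc := hb.continuous
  refine ⟨?_, ?_, ?_⟩
  · intro y₀ t₀ _ B₀ B _ hB h₀ y t hyt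
    exact PulseStability.IsMildSolution.eq_of_eqOn_Icc hN hbc
      (PulseStability.isMildSolution_zero N c b) hB h₀ hyt.2.1 hyt.1
  · intro y₀ t₀ _ A₀ B₀ A B _ _ hA hB h₀ y t hyt
    exact hA.eq_of_eqOn_Icc hN hbc hB h₀ hyt.2.1 hyt.1
  · intro ℓ A₀ B₀ A B _ _ hA hB h₀
    -- With the apex at `(y, t)` itself, the base `[y - t, y + t]` lies in `[ℓ, ∞)`.
    have h (y t : ℝ) (ht : 0 ≤ t) (hy : ℓ + t ≤ y) : B t y = A t y :=
      hA.eq_of_eqOn_Icc hN hbc hB (y₀ := y) (t₀ := t)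
        (fun z hz => h₀ z (by linarith [hz.1])) ht (by simp)
    exact ⟨h, fun x t ht hx => h _ t ht (by linarith)⟩
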